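/- **Theorem (Channel Stein's Lemma, coherent strategies).** All Hilbert spaces are finite-dimensional and nonzero, and $\log$ is the logarithm in base $2$, with $-\log 0=+\infty$. For density matrices $\rho,\sigma$ let $D(\rho\|\sigma)=\operatorname{tr}[\rho(\log\rho-\log\sigma)]$ if $\operatorname{supp}\rho\subseteq\operatorname{supp}\sigma$ and $D(\rho\|\sigma)=+\infty$ otherwise, and let $$D_H^\varepsilon(\rho\|\sigma)=-\log\inf\{\operatorname{tr}[\Pi\sigma]:0\le\Pi\le I,\ \operatorname{tr}[\Pi\rho]\ge 1-\varepsilon\}.$$ For completely positive trace-preserving maps $\mathcal N,\mathcal M$ from operators on $A$ to operators on $B$ and $\boldsymbol D\in\{D,D_H^\varepsilon\}$ put $$\boldsymbol D(\mathcal N\|\mathcal M)=\sup_{\psi}\boldsymbol D\big((\mathrm{id}_R\otimes\mathcal N)(\psi)\,\big\|\,(\mathrm{id}_R\otimes\mathcal M)(\psi)\big),$$ where the supremum is over all density matrices $\psi$ on $R\otimes A$ and all finite-dimensional reference systems $R$, and let $$D^{\rm reg}(\mathcal N\|\mathcal M)=\sup_{n\ge1}\tfrac1n D(\mathcal N^{\otimes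 n}\|\mathcal M^{\otimes n})\in[0,+\infty].$$ A coherent strategy for $n$ channel uses is a pair $S_n=(\psi_n,\Pi_n)$ of a density matrix $\psi_n$ on $R\otimes A^{\otimes n}$ ($R$ of arbitrary finite dimension) and an operator $0\le\Pi_n\le I$ on $R\otimes B^{\otimes n}$. Its errors are $$\alpha_n(S_n)=\operatorname{tr}[(I-\Pi_n)(\mathrm{id}_R\otimes\mathcal N^{\otimes n})(\psi_n)]\ \text{(Type I)},\qquad \beta_n(S_n)=\operatorname{tr}[\Pi_n(\mathrm{id}_R\otimes\mathcal M^{\otimes n})(\psi_n)]\ \text{(Type II)}.$$ The pair $(\mathcal N,\mathcal M)$ has the *exponentially strong converse property* if for every sequence of coherent strategies $(S_n)_n$ with $\liminf_{n\to\infty}-\frac1n\log\beta_n(S_n)>D^{\rm reg}(\mathcal N\|\mathcal M)$ there is $c>0$ such that $1-\alpha_n(S_n)\le2^{-cn}$ for all sufficiently large $n$. (The exponentially strong converse conjecture asserts this for all $\mathcal N,\mathcal M$ such that the Choi matrix of $\mathcal N$ is positive definite.) Let $\mathcal N,\mathcal M$ be completely positive trace-preserving maps from operators on $A$ to operators on $B$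 such that the Choi matrix of $\mathcal N$ is positive definite, and let $\varepsilon\in(0,1)$. Then, unconditionally, $$\liminf_{n\to\infty}\tfrac1n D_H^\varepsilon(\mathcal N^{\otimes n}\|\mathcal M^{\otimes n})\ \ge\ D^{\rm reg}(\mathcal N\|\mathcal M).$$ If moreover $(\mathcal N,\mathcal M)$ has the exponentially strong converse property (in particular, if the conjecture holds), then $$\lim_{n\to\infty}\tfrac1n D_H^\varepsilon(\mathcal N^{\otimes n}\|\mathcal M^{\otimes n})=D^{\rm reg}(\mathcal N\|\mathcal M),$$ and the coherent Stein exponents satisfy $$\limsup_{n\to\infty}\tfrac1n D_{H,\mathrm{COH}}^\varepsilon(n)=\liminf_{n\to\infty}\tfrac1n D_{H,\mathrm{COH}}^\varepsilon(n)=D^{\rm reg}(\mathcal N\|\mathcal M),\qquad D_{H,\mathrm{COH}}^\varepsilon(n)=\sup\{-\log\beta_n(S_n):\alpha_n(S_n)\le\varepsilon\},$$ the supremum being over all coherent strategies $S_n$ for $n$ channel uses. All equalities and limits are in $[0,+\infty]$. -/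

import Mathlib

open Filter Topology
open scoped ComplexOrder

noncomputable section

namespace ChannelStein

universe u v

/-! A finite-dimensional quantum system with a fixed orthonormal basis is represented by the finite
index type of that basis; operators on it are complex matrices.  `A^n` is `Fin n → A` and `R ⊗ A`
is `R × A`. -/

/-- Base-two logarithm of a nonnegative real, with value `-∞` at `0`. -/
def log2 (x : ℝ) : EReal :=
  open Classical in if x ≤ 0 then ⊥ else ((Real.logb 2 x : ℝ) : EReal)

section States

variable {X : Type u} [Fintype X] [DecidableEq X]

/-- Density matrices. -/
def IsDensity (ρ : Matrix X X ℂ) : Prop :=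
  ρ.PosSemidef ∧ ρ.trace = 1

/-- Effects `0 ≤ P ≤ I`, that is, binary measurements `{P, I - P}`. -/
def IsEffect (P : Matrix X X ℂ) : Prop :=
  P.PosSemidef ∧ (1 - P).PosSemidef

/-- `supp ρ ⊆ supp σ`, the support being the orthogonal complement of the kernel:
equivalently, the kernel of `σ` is contained in that of `ρ`. -/
def SuppLE (ρ σ : Matrix X X ℂ) : Prop :=
  ∀ w : X → ℂ, σ.mulVec w = 0 → ρ.mulVec w = 0

/-- The Umegaki relative entropy `tr[ρ (log ρ - log σ)]` (base two), `+∞` without support inclusion.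
The matrix logarithm is the functional calculus of `Real.logb 2`; since `Real.logb 2 0 = 0` it is
the logarithm on the support, as usual. -/
def relEntropy (ρ σ : Matrix X X ℂ) : EReal :=
  open Classical in
  if SuppLE ρ σ then
    (((ρ * (cfc (Real.logb 2) ρ - cfc (Real.logb 2) σ)).trace.re : ℝ) : EReal)
  else ⊤

/-- The hypothesis testing relative entropy `D_H^ε(ρ‖σ)`. -/
def hypTestEntropy (ε : ℝ) (ρ σ : Matrix X X ℂ) : EReal :=
  - log2 (sInf {x : ℝ | ∃ P : Matrix X X ℂ, IsEffect P ∧ 1 - ε ≤ (P * ρ).trace.re ∧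
      x = (P * σ).trace.re})

end States

section Channels

variable {A : Type u} {B : Type v} [Fintype A] [DecidableEq A] [Fintype B] [DecidableEq B]

/-- The ampliation `id_R ⊗ N`: the map `N` is applied to each `A`-block of a matrix on `R ⊗ A`. -/
def ampliate (R : Type*) (N : Matrix A A ℂ →ₗ[ℂ] Matrix B B ℂ)
    (X : Matrix (R × A) (R × A) ℂ) : Matrix (R × B) (R × B) ℂ :=
  Matrix.of fun p q => N (Matrix.of fun a a' => X (p.1, a) (q.1, a')) p.2 q.2

/-- Completely positive trace-preserving maps. -/
def IsCPTP (N : Matrix A A ℂ →ₗ[ℂ] Matrix B B ℂ) : Prop :=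
  (∀ (d : ℕ) (X : Matrix (Fin d × A) (Fin d × A) ℂ),
    X.PosSemidef → (ampliate (Fin d) N X).PosSemidef) ∧
  ∀ X : Matrix A A ℂ, (N X).trace = X.trace

/-- The unnormalized maximally entangled state `|Φ⟩⟨Φ|`, `|Φ⟩ = ∑ i, |i⟩ ⊗ |i⟩`. -/
def maxEntangled (A : Type u) [DecidableEq A] : Matrix (A × A) (A × A) ℂ :=
  Matrix.of fun p q => if p.1 = p.2 ∧ q.1 = q.2 then 1 else 0

/-- The Choi matrix of a linear map. -/
def choi (N : Matrix A A ℂ →ₗ[ℂ] Matrix B B ℂ) : Matrix (A × B) (A × B) ℂ :=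
  ampliate A N (maxEntangled A)

/-- The tensor power `N^{⊗n}`: the linear map sending each matrix unit
`|a⟩⟨a'| = ⨂ i, |a i⟩⟨a' i|` to `⨂ i, N(|a i⟩⟨a' i|)`. -/
def tensorPower (n : ℕ) (N : Matrix A A ℂ →ₗ[ℂ] Matrix B B ℂ) :
    Matrix (Fin n → A) (Fin n → A) ℂ →ₗ[ℂ] Matrix (Fin n → B) (Fin n → B) ℂ where
  toFun X := Matrix.of fun b b' =>
    ∑ a, ∑ a', X a a' * ∏ i, N (Matrix.single (a i) (a' i) 1) (b i) (b' i)
  map_add' X Y := by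
    ext b b'
    simp [add_mul, Finset.sum_add_distrib]
  map_smul' c X := by
    ext b b'
    simp [mul_assoc, Finset.mul_sum]

/-- The channel relative entropy `D(N‖M)`: supremum over all input states with a reference system
of arbitrary finite dimension. -/
def channelRelEntropy (N M : Matrix A A ℂ →ₗ[ℂ] Matrix B B ℂ) : EReal :=
  ⨆ (d : ℕ) (ψ : Matrix (Fin d × A) (Fin d × A) ℂ) (_ : IsDensity ψ),
    relEntropy (ampliate (Fin d) N ψ) (ampliate (Fin d) M ψ)

/-- The channel hypothesis testing relative entropy `D_H^ε(N‖M)`. -/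
def channelHypTestEntropy (ε : ℝ) (N M : Matrix A A ℂ →ₗ[ℂ] Matrix B B ℂ) : EReal :=
  ⨆ (d : ℕ) (ψ : Matrix (Fin d × A) (Fin d × A) ℂ) (_ : IsDensity ψ),
    hypTestEntropy ε (ampliate (Fin d) N ψ) (ampliate (Fin d) M ψ)

/-- The regularized channel relative entropy `sup_{n ≥ 1} (1/n) D(N^{⊗n}‖M^{⊗n})`. -/
def regRelEntropy (N M : Matrix A A ℂ →ₗ[ℂ] Matrix B B ℂ) : EReal :=
  ⨆ (n : ℕ) (_ : 1 ≤ n),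
    ((1 / (n : ℝ) : ℝ) : EReal) * channelRelEntropy (tensorPower n N) (tensorPower n M)

end Channels

/-- A coherent (parallel) strategy for `n` uses of a channel from `A` to `B`: a state on `R ⊗ A^n`
with `R` of arbitrary finite dimension, and a binary measurement on `R ⊗ B^n`. -/
structure CoherentStrategy (A : Type u) (B : Type v) [Fintype A] [DecidableEq A] [Fintype B]
    [DecidableEq B] (n : ℕ) where
  refDim : ℕ
  input : Matrix (Fin refDim × (Fin n → A)) (Fin refDim × (Fin n → A)) ℂ
  input_isDensity : IsDensity input
  effect : Matrix (Fin refDim × (Fin n → B)) (Fin refDim × (Fin n → B)) ℂ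
  effect_isEffect : IsEffect effect

section Discrimination

variable {A : Type u} {B : Type v} [Fintype A] [DecidableEq A] [Fintype B] [DecidableEq B]

/-- The state `G^{⊗n}(ψ_n)` on which the measurement is performed when the channel is `G`. -/
def CoherentStrategy.testState {n : ℕ} (S : CoherentStrategy A B n)
    (G : Matrix A A ℂ →ₗ[ℂ] Matrix B B ℂ) :
    Matrix (Fin S.refDim × (Fin n → B)) (Fin S.refDim × (Fin n → B)) ℂ :=
  ampliate (Fin S.refDim) (tensorPower n G) S.input

/-- Type I error, for the null hypothesis `N`. -/
def CoherentStrategy.typeI {n : ℕ} (S : CoherentStrategy A B n)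
    (N : Matrix A A ℂ →ₗ[ℂ] Matrix B B ℂ) : ℝ :=
  ((1 - S.effect) * S.testState N).trace.re

/-- Type II error, for the alternative hypothesis `M`. -/
def CoherentStrategy.typeII {n : ℕ} (S : CoherentStrategy A B n)
    (M : Matrix A A ℂ →ₗ[ℂ] Matrix B B ℂ) : ℝ :=
  (S.effect * S.testState M).trace.re

/-- The exponentially strong converse property of the pair `(N, M)` under coherent strategies: if
the Type II errors of a sequence of strategies decay with exponent larger than `D^reg(N‖M)`, then
one minus the Type I error decays exponentially. -/
def ExpStrongConverse (N M : Matrix A A ℂ →ₗ[ℂ] Matrix B B ℂ) : Prop :=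
  ∀ S : (n : ℕ) → CoherentStrategy A B n,
    regRelEntropy N M <
        liminf (fun n : ℕ => ((1 / (n : ℝ) : ℝ) : EReal) * (- log2 ((S n).typeII M))) atTop →
    ∃ c : ℝ, 0 < c ∧ ∀ᶠ n : ℕ in atTop, 1 - (S n).typeI N ≤ (2 : ℝ) ^ (-(c * (n : ℝ)))

/-- `D_{H,COH}^ε(N^{⊗n}‖M^{⊗n})`: the optimal value of `-log β_n` over coherent strategies with
Type I error at most `ε`. -/
def coherentHypTestEntropy (ε : ℝ) (N M : Matrix A A ℂ →ₗ[ℂ] Matrix B B ℂ) (n : ℕ) : EReal :=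
  ⨆ (S : CoherentStrategy A B n) (_ : S.typeI N ≤ ε), - log2 (S.typeII M)

/-- The upper Stein exponent for coherent strategies. -/
def steinExponentSup (ε : ℝ) (N M : Matrix A A ℂ →ₗ[ℂ] Matrix B B ℂ) : EReal :=
  limsup (fun n : ℕ => ((1 / (n : ℝ) : ℝ) : EReal) * coherentHypTestEntropy ε N M n) atTop

/-- The lower Stein exponent for coherent strategies. -/
def steinExponentInf (ε : ℝ) (N M : Matrix A A ℂ →ₗ[ℂ] Matrix B B ℂ) : EReal :=
  liminf (fun n : ℕ => ((1 / (n : ℝ) : ℝ) : EReal) * coherentHypTestEntropy ε N M n) atTop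

end Discrimination

end ChannelStein

end

/-! Lower bound. Fix `k`, an input `ψ` for `k` uses and a real `l` below the relative entropy of its
two outputs. For `n` uses, feed in `n / k` copies of `ψ` and fill the leftover uses with a fixed
state that the test ignores. The outputs are then i.i.d. copies, so achievability in the quantum
Stein lemma (`exists_stein_effect`) gives Type I error tending to `0` and Type II exponent at least
`l / k`; the suprema over `l`, `ψ` and `k` give `regRelEntropy_le_liminf`.

The Stein lemma rests on Audenaert's inequality (`exists_effect_trace_le`), which bounds the error
of a test by `tr ρ^(1-s) σ^s`, a quantity multiplicative under tensor powers. By diagonalization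
`2^(ls) tr ρ^(1-s) σ^s` is a classical sum whose slope at `s = 0` is `(l - D) log 2 < 0`, so it is
below one for small `s`; without support inclusion its limit at `0` is already below one. Taking `s
= 1/(k+1)` leaves only integer powers of roots.

Upper bound (`limsup_le_regRelEntropy`). If the limsup exceeded `D^reg`, strategies with Type I
error at most `ε` and too large an exponent would exist for infinitely many `n`. Completing them by
tests with zero Type II error gives a full sequence to which the strong converse applies; it forces
success probability tending to `0`, against `1 - ε`. -/

noncomputable section

namespace ChannelStein

universe u v

/-! ### Audenaert's trace inequality, by Ozawa's argument. -/

section Ozawa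

open scoped MatrixOrder Matrix.Norms.L2Operator

variable {X : Type*} [Fintype X] [DecidableEq X]

lemma trace_mul_re_nonneg {S T : Matrix X X ℂ} (hS : S.PosSemidef) (hT : T.PosSemidef) :
    0 ≤ (S * T).trace.re := by
  obtain ⟨Y, rfl⟩ := (CStarAlgebra.nonneg_iff_eq_star_mul_self (a := S)).1 hS.nonneg
  have h : (Y * T * Y.conjTranspose).PosSemidef := hT.mul_mul_conjTranspose_same Y
  have h2 := h.trace_nonneg
  rw [Matrix.trace_mul_comm, ← mul_assoc] at h2
  exact (Complex.le_def.1 h2).1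

lemma trace_mul_re_mono {S T T' : Matrix X X ℂ} (hS : S.PosSemidef) (h : T ≤ T') :
    (S * T).trace.re ≤ (S * T').trace.re := by
  have := trace_mul_re_nonneg hS h
  rw [mul_sub, Matrix.trace_sub, Complex.sub_re] at this
  linarith

lemma pow_rpow_div {S : Matrix X X ℂ} (hS : 0 ≤ S) (k j : ℕ) :
    (S ^ (k + 1)) ^ ((j : ℝ) / (k + 1)) = S ^ j := by
  rw [← CFC.rpow_natCast S (k + 1), CFC.rpow_rpow_of_exponent_nonneg _ _ _ (by positivity)
    (by positivity), ← CFC.rpow_natCast S j]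
  congr 1
  push_cast
  field_simp

/-- Löwner–Heinz: `x ↦ x^(j/(k+1))` is operator monotone, the exponent being at most one. -/
lemma pow_le_pow_of_pow_succ_le {S T : Matrix X X ℂ} (hS : 0 ≤ S) (hT : 0 ≤ T) {k j : ℕ}
    (hj : j ≤ k + 1) (h : S ^ (k + 1) ≤ T ^ (k + 1)) : S ^ j ≤ T ^ j := by
  rw [← pow_rpow_div hS k j, ← pow_rpow_div hT k j]
  refine CFC.rpow_le_rpow ⟨by positivity, ?_⟩ h
  rw [div_le_one (by positivity)]
  exact_mod_cast hj

lemma rpow_one_div_pow_succ {S : Matrix X X ℂ} (hS : 0 ≤ S) (k : ℕ) :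
    (S ^ (1 / ((k : ℝ) + 1))) ^ (k + 1) = S := by
  rw [← CFC.rpow_natCast _ (k + 1) CFC.rpow_nonneg,
    CFC.rpow_rpow_of_exponent_nonneg _ _ _ (by positivity) (by positivity)]
  have : 1 / ((k : ℝ) + 1) * ((k + 1 : ℕ) : ℝ) = 1 := by
    push_cast; field_simp
  rw [this, CFC.rpow_one S hS]

/-- The spectrum is finite, so the functional calculus accepts discontinuous functions such as
indicators and `Real.logb 2`. -/
lemma continuousOn_spectrum (H : Matrix X X ℂ) (f : ℝ → ℝ) : ContinuousOn f (spectrum ℝ H) :=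
  H.finite_real_spectrum.continuousOn f

/-- The positive part of a Hermitian matrix, together with the projection realizing it. -/
lemma exists_effect_mul_eq_posPart {H : Matrix X X ℂ} (hH : H.IsHermitian) :
    ∃ P : Matrix X X ℂ, IsEffect P ∧ 0 ≤ P * H ∧ H ≤ P * H := by
  have hsa : IsSelfAdjoint H := hH
  set e : ℝ → ℝ := fun x => if 0 < x then 1 else 0 with he
  have hPH : cfc e H * H = cfc (fun x => e x * x) H := by
    rw [cfc_mul e (fun x => x) H (continuousOn_spectrum H _)
      (continuousOn_spectrum H _), cfc_id' ℝ H]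
  refine ⟨cfc e H, ⟨?_, ?_⟩, ?_, ?_⟩
  · refine Matrix.LE.le.posSemidef (cfc_nonneg fun x _ => ?_)
    simp only [he]; split_ifs <;> norm_num
  · refine Matrix.le_iff.1 (cfc_le_one e H fun x _ => ?_)
    simp only [he]; split_ifs <;> norm_num
  · rw [hPH]
    refine cfc_nonneg fun x _ => ?_
    simp only [he]; split_ifs with h
    · simpa using h.le
    · simp
  · rw [hPH]
    conv_lhs => rw [← cfc_id' ℝ H]
    refine cfc_mono (fun x _ => ?_) (continuousOn_spectrum H _) (continuousOn_spectrum H _)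
    simp only [he]; split_ifs with h
    · simp
    · simpa using h

/-- Audenaert's trace inequality in the form of the error bound for an optimal test. -/
theorem exists_effect_trace_le {S T : Matrix X X ℂ} (hS : S.PosSemidef) (hT : T.PosSemidef)
    (k : ℕ) : ∃ P : Matrix X X ℂ, IsEffect P ∧
      ((1 - P) * S ^ (k + 1)).trace.re + (P * T ^ (k + 1)).trace.re ≤
        (S ^ k * T).trace.re := by
  have hH : (S ^ (k + 1) - T ^ (k + 1)).IsHermitian := (hS.1.pow _).sub (hT.1.pow _)
  obtain ⟨P, hP, hpos, hle⟩ := exists_effect_mul_eq_posPart hH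
  refine ⟨P, hP, ?_⟩
  set Δ := P * (S ^ (k + 1) - T ^ (k + 1)) with hΔ
  have hTk : 0 ≤ T ^ (k + 1) := (hT.pow _).nonneg
  -- `Δ` is the positive part of `S^(k+1) - T^(k+1)`, so `Z^(k+1)` dominates both powers and `Z` is
  -- a common upper bound of `S` and `T`.
  obtain ⟨Z, hZ, hZeq⟩ : ∃ Z : Matrix X X ℂ, 0 ≤ Z ∧ Z ^ (k + 1) = T ^ (k + 1) + Δ :=
    ⟨_, CFC.rpow_nonneg, rpow_one_div_pow_succ (add_nonneg hTk hpos) k⟩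
  have hS0 := hS.nonneg
  have hT0 := hT.nonneg
  have hSZ : S ^ (k + 1) ≤ Z ^ (k + 1) := by
    rw [hZeq]; exact sub_le_iff_le_add'.1 hle
  have hTZ : T ^ (k + 1) ≤ Z ^ (k + 1) := by
    rw [hZeq]; exact le_add_of_nonneg_right hpos
  have h1 : S ≤ Z := by
    simpa using pow_le_pow_of_pow_succ_le hS0 hZ (j := 1) (by omega) hSZ
  have h2 : S ^ k ≤ Z ^ k := pow_le_pow_of_pow_succ_le hS0 hZ (by omega) hSZ
  have h3 : T ≤ Z := by
    simpa using pow_le_pow_of_pow_succ_le hT0 hZ (j := 1) (by omega) hTZ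
  have h4 : T ^ k ≤ Z ^ k := pow_le_pow_of_pow_succ_le hT0 hZ (by omega) hTZ
  -- The chain is `tr S^k (S - T) ≤ tr S^k (Z - T) ≤ tr Z^k (Z - T) ≤ tr Z^(k+1) - tr T^(k+1) = tr
  -- Δ`.
  have e1 := trace_mul_re_mono (hS.pow k) h1
  have e2 := trace_mul_re_mono (Matrix.le_iff.1 h3) h2
  have e3 := trace_mul_re_mono hT h4
  rw [Matrix.trace_mul_comm, Matrix.trace_mul_comm _ (Z ^ k)] at e2
  rw [Matrix.trace_mul_comm, Matrix.trace_mul_comm _ (Z ^ k)] at e3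
  simp only [mul_sub, Matrix.trace_sub, Complex.sub_re, ← pow_succ] at e1 e2 e3
  rw [hZeq, Matrix.trace_add, Complex.add_re, hΔ, mul_sub, Matrix.trace_sub, Complex.sub_re] at e2
  rw [sub_mul, one_mul, Matrix.trace_sub, Complex.sub_re]
  linarith

end Ozawa

/-! ### Reduction of two noncommuting matrices to classical weights. -/

section Spectral

variable {X : Type*} [Fintype X] [DecidableEq X]

/-- Squared overlaps of the eigenvectors of two Hermitian matrices. -/
def overlap {ρ σ : Matrix X X ℂ} (hρ : ρ.IsHermitian) (hσ : σ.IsHermitian) (i j : X) : ℝ :=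
  Complex.normSq ((star (hρ.eigenvectorUnitary : Matrix X X ℂ) *
    (hσ.eigenvectorUnitary : Matrix X X ℂ)) i j)

/-- The Nussbaum–Szkoła device: relative entropy and quasi-entropies become scalar sums with the
same weights. -/
lemma trace_cfc_mul_cfc {ρ σ : Matrix X X ℂ} (hρ : ρ.IsHermitian) (hσ : σ.IsHermitian)
    (f g : ℝ → ℝ) : (cfc f ρ * cfc g σ).trace.re =
      ∑ i, ∑ j, f (hρ.eigenvalues i) * g (hσ.eigenvalues j) * overlap hρ hσ i j := by
  rw [hρ.cfc_eq, hσ.cfc_eq, Matrix.IsHermitian.cfc, Matrix.IsHermitian.cfc,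
    Unitary.conjStarAlgAut_apply, Unitary.conjStarAlgAut_apply]
  set U := (hρ.eigenvectorUnitary : Matrix X X ℂ) with hU
  set V := (hσ.eigenvectorUnitary : Matrix X X ℂ) with hV
  set W := star U * V with hW
  have : (U * Matrix.diagonal (RCLike.ofReal ∘ f ∘ hρ.eigenvalues) * star U *
      (V * Matrix.diagonal (RCLike.ofReal ∘ g ∘ hσ.eigenvalues) * star V)).trace =
      (Matrix.diagonal (RCLike.ofReal ∘ f ∘ hρ.eigenvalues) *
        (W * Matrix.diagonal (RCLike.ofReal ∘ g ∘ hσ.eigenvalues) * star W)).trace := by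
    rw [mul_assoc U, mul_assoc U, Matrix.trace_mul_comm U]
    simp only [hW, star_mul, star_star, mul_assoc]
  rw [this, Matrix.trace, Complex.re_sum]
  refine Finset.sum_congr rfl fun i _ => ?_
  rw [Matrix.diag_apply, Matrix.diagonal_mul, Matrix.mul_apply, Finset.mul_sum, Complex.re_sum]
  refine Finset.sum_congr rfl fun j _ => ?_
  rw [Matrix.mul_diagonal, Matrix.star_apply, overlap, ← hU, ← hV, ← hW]
  have : W i j * (RCLike.ofReal ∘ g ∘ hσ.eigenvalues) j * star (W i j) =
      ((g (hσ.eigenvalues j) * Complex.normSq (W i j) : ℝ) : ℂ) := by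
    push_cast
    rw [Complex.normSq_eq_conj_mul_self]
    simp only [Function.comp_apply, Complex.coe_algebraMap, RCLike.star_def]
    ring
  rw [this]
  change (((f (hρ.eigenvalues i) : ℝ) : ℂ) * _).re = _
  rw [← Complex.ofReal_mul, Complex.ofReal_re]
  ring

/-- In the two eigenbases `ρ` has entries `λ_i W_ij`, with `W` the overlap unitary; support
inclusion says that the columns belonging to `ker σ` vanish. -/
lemma suppLE_iff_overlap {ρ σ : Matrix X X ℂ} (hρ : ρ.IsHermitian) (hσ : σ.IsHermitian) :
    SuppLE ρ σ ↔ ∀ i j, hρ.eigenvalues i ≠ 0 → hσ.eigenvalues j = 0 → overlap hρ hσ i j = 0 := by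
  set U := (hρ.eigenvectorUnitary : Matrix X X ℂ) with hU
  set V := (hσ.eigenvectorUnitary : Matrix X X ℂ) with hV
  have hUU : star U * U = 1 := Unitary.coe_star_mul_self _
  have hUU' : U * star U = 1 := Unitary.coe_mul_star_self _
  have hVV : star V * V = 1 := Unitary.coe_star_mul_self _
  have hVV' : V * star V = 1 := Unitary.coe_mul_star_self _
  have hρe : ρ = U * Matrix.diagonal (fun i => (hρ.eigenvalues i : ℂ)) * star U := by
    conv_lhs => rw [hρ.spectral_theorem, Unitary.conjStarAlgAut_apply]
    rfl
  have hσe : σ = V * Matrix.diagonal (fun i => (hσ.eigenvalues i : ℂ)) * star V := by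
    conv_lhs => rw [hσ.spectral_theorem, Unitary.conjStarAlgAut_apply]
    rfl
  have hover : ∀ i j, overlap hρ hσ i j = 0 ↔ (star U * V) i j = 0 := fun i j => by
    rw [overlap, Complex.normSq_eq_zero]
  simp only [hover]
  have hdiag : ∀ i j, (Matrix.diagonal (fun i => (hρ.eigenvalues i : ℂ)) * (star U * V)) i j =
      (star U * (ρ * V)) i j := fun i j => by
    conv_rhs => rw [hρe]
    simp only [← mul_assoc, hUU, one_mul]
  constructor
  · intro h i j hi hj
    have h1 : σ.mulVec (V.mulVec (Pi.single j 1)) = 0 := by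
      have : σ * V = V * Matrix.diagonal (fun i => (hσ.eigenvalues i : ℂ)) := by
        conv_lhs => rw [hσe]
        rw [mul_assoc, hVV, mul_one]
      rw [Matrix.mulVec_mulVec, this, ← Matrix.mulVec_mulVec, Matrix.diagonal_mulVec_single]
      simp [hj]
    have h2 := h _ h1
    have h3 : (star U * (ρ * V)) i j = 0 := by
      have : (star U * (ρ * V)).mulVec (Pi.single j 1) = 0 := by
        rw [← Matrix.mulVec_mulVec, ← Matrix.mulVec_mulVec, h2, Matrix.mulVec_zero]
      simpa using congrFun this i
    rw [← hdiag, Matrix.diagonal_mul] at h3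
    exact (mul_eq_zero.1 h3).resolve_left (by exact_mod_cast hi)
  · intro h w hw
    set z := (star V).mulVec w with hz
    have hwz : w = V.mulVec z := by rw [hz, Matrix.mulVec_mulVec, hVV', Matrix.one_mulVec]
    have hzj : ∀ j, hσ.eigenvalues j ≠ 0 → z j = 0 := by
      intro j hj
      have : (Matrix.diagonal (fun i => (hσ.eigenvalues i : ℂ))).mulVec z = 0 := by
        have h0 : (star V).mulVec (σ.mulVec w) = 0 := by rw [hw, Matrix.mulVec_zero]
        rw [hσe, Matrix.mulVec_mulVec] at h0
        rw [hz, Matrix.mulVec_mulVec, ← h0]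
        simp only [← mul_assoc, hVV, one_mul]
      have h1 := congrFun this j
      rw [Matrix.mulVec_diagonal] at h1
      exact (mul_eq_zero.1 h1).resolve_left (by exact_mod_cast hj)
    have key : (star U * (ρ * V)).mulVec z = 0 := by
      ext i
      rw [Matrix.mulVec, dotProduct, Pi.zero_apply]
      refine Finset.sum_eq_zero fun j _ => ?_
      rw [← hdiag, Matrix.diagonal_mul]
      by_cases hj : hσ.eigenvalues j = 0
      · by_cases hi : hρ.eigenvalues i = 0
        · simp [hi]
        · simp [h i j hi hj]
      · simp [hzj j hj]
    have : ρ.mulVec w = U.mulVec ((star U * (ρ * V)).mulVec z) := by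
      rw [Matrix.mulVec_mulVec, ← mul_assoc, hUU', one_mul, ← Matrix.mulVec_mulVec, ← hwz]
    rw [this, key, Matrix.mulVec_zero]

end Spectral

/-! ### The classical Chernoff-type estimate. -/

section Scalar

/-- If `l` is smaller than the (classical) relative entropy, possibly infinite, of the
Nussbaum–Szkoła pair given by `p`, `q` and `w`, then a Chernoff-type quantity is below one. -/
lemma exists_chernoff_lt_one {ι : Type*} [Fintype ι] {p q w : ι → ℝ} (hp : ∀ i, 0 ≤ p i)
    (hq : ∀ i, 0 ≤ q i) (hw : ∀ i, 0 ≤ w i) (hsum : ∑ i, p i * w i = 1) (l : ℝ)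
    (h : (∀ i, p i ≠ 0 → q i = 0 → w i = 0) →
      l < ∑ i, p i * w i * (Real.logb 2 (p i) - Real.logb 2 (q i))) :
    ∃ k : ℕ, (2 : ℝ) ^ (l / (k + 1)) *
      ∑ i, p i ^ ((k : ℝ) / (k + 1)) * q i ^ ((1 : ℝ) / (k + 1)) * w i < 1 := by
  classical
  -- Indices with `p i = 0` or `q i = 0` contribute nothing for `0 < s < 1`. Without them the
  -- quantity is the smooth function `F s`, with `s = 1/(k+1)`.
  set a : ι → ℝ := fun i => if p i = 0 ∨ q i = 0 then 0 else p i * w i with ha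
  set r : ι → ℝ := fun i => Real.log (q i) - Real.log (p i) + l * Real.log 2 with hr
  set F : ℝ → ℝ := fun s => ∑ i, a i * Real.exp (s * r i) with hF
  have hF0 : F 0 = ∑ i, a i := by simp [hF]
  have hderiv : HasDerivAt F (∑ i, a i * r i) 0 := by
    have : ∀ i ∈ (Finset.univ : Finset ι),
        HasDerivAt (fun s : ℝ => a i * Real.exp (s * r i)) (a i * r i) 0 := fun i _ => by
      have h1 : HasDerivAt (fun s : ℝ => s * r i) (r i) 0 := by
        simpa using (hasDerivAt_id (0 : ℝ)).mul_const (r i)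
      simpa using (h1.exp).const_mul (a i)
    exact HasDerivAt.fun_sum this
  have hle : ∀ i, a i ≤ p i * w i := fun i => by
    simp only [ha]
    split_ifs
    · exact mul_nonneg (hp i) (hw i)
    · exact le_rfl
  have hev : ∀ᶠ s in 𝓝[>] (0 : ℝ), F s < 1 := by
    by_cases hsupp : ∀ i, p i ≠ 0 → q i = 0 → w i = 0
    · have haeq : ∀ i, a i = p i * w i := fun i => by
        simp only [ha]
        split_ifs with hc
        · by_cases hpi : p i = 0
          · simp [hpi]
          · simp [hsupp i hpi (hc.resolve_left hpi)]
        · rfl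
      have hF1 : F 0 = 1 := by rw [hF0]; simpa [haeq] using hsum
      have hneg : ∑ i, a i * r i < 0 := by
        have h2 := h hsupp
        have hl2 : 0 < Real.log 2 := Real.log_pos (by norm_num)
        have : ∑ i, a i * r i = (l - ∑ i, p i * w i *
            (Real.logb 2 (p i) - Real.logb 2 (q i))) * Real.log 2 := by
          have hl : l = ∑ i, p i * w i * l := by rw [← Finset.sum_mul, hsum, one_mul]
          conv_rhs => rw [hl]
          rw [← Finset.sum_sub_distrib, Finset.sum_mul]
          refine Finset.sum_congr rfl fun i _ => ?_
          rw [haeq, hr, Real.logb, Real.logb]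
          field_simp
          ring
        rw [this]
        exact mul_neg_of_neg_of_pos (by linarith) hl2
      have hslope := hderiv.hasDerivWithinAt (s := Set.Ioi 0)
      rw [hasDerivWithinAt_iff_tendsto_slope' (by simp)] at hslope
      filter_upwards [hslope.eventually_lt_const hneg, self_mem_nhdsWithin] with s hs hs0
      rw [slope_def_field, sub_zero, hF1, div_neg_iff] at hs
      rcases hs with hs | hs
      · exact absurd hs0 (not_lt.2 hs.2.le)
      · linarith [hs.1]
    -- Infinite relative entropy: `F 0` has lost positive mass, so continuity suffices in place of
    -- the slope.
    · push Not at hsupp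
      obtain ⟨i, hpi, hqi, hwi⟩ := hsupp
      have hlt : F 0 < 1 := by
        rw [hF0, ← hsum]
        refine Finset.sum_lt_sum (fun i _ => hle i) ⟨i, Finset.mem_univ i, ?_⟩
        simp only [ha, hqi, or_true, if_true]
        exact mul_pos ((hp i).lt_of_ne' hpi) ((hw i).lt_of_ne' hwi)
      exact (hderiv.continuousAt.eventually_lt_const hlt).filter_mono nhdsWithin_le_nhds
  have ht : Tendsto (fun k : ℕ => 1 / ((k : ℝ) + 1)) atTop (𝓝[>] 0) :=
    tendsto_nhdsWithin_iff.2 ⟨tendsto_one_div_add_atTop_nhds_zero_nat,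
      Eventually.of_forall fun k => by simp only [Set.mem_Ioi]; positivity⟩
  -- `k ≥ 1` excludes the convention `0 ^ 0 = 1` in `p i ^ (k/(k+1))`.
  obtain ⟨k, hk, hk1⟩ := ((ht.eventually hev).and (eventually_ge_atTop 1)).exists
  refine ⟨k, lt_of_eq_of_lt ?_ hk⟩
  have hk0 : (0 : ℝ) < k := by exact_mod_cast hk1
  rw [hF, Finset.mul_sum]
  refine Finset.sum_congr rfl fun i _ => ?_
  simp only [ha]
  split_ifs with hc
  · rcases hc with hc | hc
    · rw [hc, Real.zero_rpow (by positivity)]; simp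
    · rw [hc, Real.zero_rpow (by positivity)]; simp
  · push Not at hc
    have hpi := (hp i).lt_of_ne' hc.1
    have hqi := (hq i).lt_of_ne' hc.2
    rw [Real.rpow_def_of_pos hpi, Real.rpow_def_of_pos hqi, Real.rpow_def_of_pos two_pos]
    have : p i = Real.exp (Real.log (p i)) := (Real.exp_log hpi).symm
    conv_rhs => rw [this]
    rw [← mul_assoc, ← mul_assoc, mul_right_comm _ (w i), ← Real.exp_add, ← Real.exp_add,
      ← Real.exp_add]
    congr 2
    simp only [hr]
    field_simp
    ring

end Scalar

/-! ### Tensor powers of matrices. -/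

section TensorMatrix

variable {X : Type*} (ι : Type*) [Fintype ι]

/-- The tensor power `S^{⊗ι}` of a matrix. -/
def tensorMatrix (S : Matrix X X ℂ) : Matrix (ι → X) (ι → X) ℂ :=
  Matrix.of fun x y => ∏ i, S (x i) (y i)

lemma tensorMatrix_mul [Fintype X] [DecidableEq ι] (S T : Matrix X X ℂ) :
    tensorMatrix ι (S * T) = tensorMatrix ι S * tensorMatrix ι T := by
  ext x y
  simp only [tensorMatrix, Matrix.of_apply, Matrix.mul_apply, Finset.prod_univ_sum,
    Fintype.piFinset_univ, Finset.prod_mul_distrib]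

lemma tensorMatrix_conjTranspose (S : Matrix X X ℂ) :
    tensorMatrix ι S.conjTranspose = (tensorMatrix ι S).conjTranspose := by
  ext x y
  simp [tensorMatrix]

lemma tensorMatrix_one [DecidableEq X] : tensorMatrix ι (1 : Matrix X X ℂ) = 1 := by
  ext x y
  simp only [tensorMatrix, Matrix.of_apply, Matrix.one_apply, Finset.prod_ite_zero]
  simp [funext_iff]

lemma tensorMatrix_pow [Fintype X] [DecidableEq X] [DecidableEq ι] (S : Matrix X X ℂ) (k : ℕ) :
    tensorMatrix ι (S ^ k) = tensorMatrix ι S ^ k := by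
  induction k with
  | zero => simp [tensorMatrix_one]
  | succ k ih => rw [pow_succ, tensorMatrix_mul, ih, pow_succ]

lemma tensorMatrix_smul (c : ℂ) (S : Matrix X X ℂ) :
    tensorMatrix ι (c • S) = c ^ Fintype.card ι • tensorMatrix ι S := by
  ext x y
  simp [tensorMatrix, Finset.prod_mul_distrib]

lemma trace_tensorMatrix [Fintype X] [DecidableEq ι] (S : Matrix X X ℂ) :
    (tensorMatrix ι S).trace = S.trace ^ Fintype.card ι := by
  simp only [tensorMatrix, Matrix.trace, Matrix.diag_apply, Matrix.of_apply]
  rw [← Fintype.piFinset_univ, ← Finset.prod_univ_sum (fun _ : ι => Finset.univ)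
    (fun _ x => S x x)]
  simp

open scoped MatrixOrder Matrix.Norms.L2Operator in
lemma posSemidef_tensorMatrix [Fintype X] [DecidableEq X] [DecidableEq ι]
    {S : Matrix X X ℂ} (hS : S.PosSemidef) :
    (tensorMatrix ι S).PosSemidef := by
  obtain ⟨Y, rfl⟩ := (CStarAlgebra.nonneg_iff_eq_star_mul_self (a := S)).1 hS.nonneg
  rw [tensorMatrix_mul, Matrix.star_eq_conjTranspose, tensorMatrix_conjTranspose]
  exact Matrix.posSemidef_conjTranspose_mul_self _

lemma isDensity_tensorMatrix [Fintype X] [DecidableEq X] [DecidableEq ι]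
    {S : Matrix X X ℂ} (hS : IsDensity S) :
    IsDensity (tensorMatrix ι S) :=
  ⟨posSemidef_tensorMatrix ι hS.1, by rw [trace_tensorMatrix, hS.2, one_pow]⟩

end TensorMatrix

/-! ### Achievability for i.i.d. states. -/

section Stein

variable {X : Type*} [Fintype X] [DecidableEq X]

open scoped MatrixOrder Matrix.Norms.L2Operator in
/-- The eigenvalue decomposition turns `l < D(ρ‖σ)` into a bound on a quasi-entropy. -/
lemma exists_roots_trace_lt_one {ρ σ : Matrix X X ℂ} (hρ : IsDensity ρ) (hσ : IsDensity σ) {l : ℝ}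
    (hl : (l : EReal) < relEntropy ρ σ) :
    ∃ (k : ℕ) (S T : Matrix X X ℂ), S.PosSemidef ∧ T.PosSemidef ∧ S ^ (k + 1) = ρ ∧
      T ^ (k + 1) = σ ∧ (2 : ℝ) ^ (l / (k + 1)) * (S ^ k * T).trace.re < 1 := by
  have hρh := hρ.1.1
  have hσh := hσ.1.1
  have hρ0 := hρ.1.nonneg
  have hσ0 := hσ.1.nonneg
  have hρs : IsSelfAdjoint ρ := hρh
  have hσs : IsSelfAdjoint σ := hσh
  have hsum : ∑ z : X × X, hρh.eigenvalues z.1 * overlap hρh hσh z.1 z.2 = 1 := by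
    have := trace_cfc_mul_cfc hρh hσh (fun x => x) (fun _ => 1)
    rw [cfc_id' ℝ ρ, cfc_const_one ℝ σ, mul_one, hρ.2] at this
    rw [Fintype.sum_prod_type]
    simpa using this.symm
  obtain ⟨k, hk⟩ := exists_chernoff_lt_one (p := fun z : X × X => hρh.eigenvalues z.1)
    (q := fun z => hσh.eigenvalues z.2) (w := fun z => overlap hρh hσh z.1 z.2)
    (fun z => hρ.1.eigenvalues_nonneg _) (fun z => hσ.1.eigenvalues_nonneg _)
    (fun z => Complex.normSq_nonneg _) hsum l (fun hs => by
      have hS : SuppLE ρ σ := (suppLE_iff_overlap hρh hσh).2 fun i j => hs (i, j)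
      rw [relEntropy, if_pos hS, EReal.coe_lt_coe_iff] at hl
      refine hl.trans_eq ?_
      have h1 : ρ * cfc (Real.logb 2) ρ = cfc (fun x => x * Real.logb 2 x) ρ *
          cfc (fun _ : ℝ => (1 : ℝ)) σ := by
        rw [cfc_const_one ℝ σ, mul_one, cfc_mul (fun x => x) (Real.logb 2) ρ
          (continuousOn_spectrum ρ _) (continuousOn_spectrum ρ _), cfc_id' ℝ ρ]
      have h2 : ρ * cfc (Real.logb 2) σ = cfc (fun x : ℝ => x) ρ * cfc (Real.logb 2) σ := by
        rw [cfc_id' ℝ ρ]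
      rw [mul_sub, Matrix.trace_sub, Complex.sub_re, h1, h2, trace_cfc_mul_cfc hρh hσh,
        trace_cfc_mul_cfc hρh hσh, Fintype.sum_prod_type, ← Finset.sum_sub_distrib]
      refine Finset.sum_congr rfl fun i _ => ?_
      rw [← Finset.sum_sub_distrib]
      refine Finset.sum_congr rfl fun j _ => ?_
      ring)
  refine ⟨k, ρ ^ (1 / ((k : ℝ) + 1)), σ ^ (1 / ((k : ℝ) + 1)),
    Matrix.nonneg_iff_posSemidef.1 CFC.rpow_nonneg, Matrix.nonneg_iff_posSemidef.1 CFC.rpow_nonneg,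
    rpow_one_div_pow_succ hρ0 k, rpow_one_div_pow_succ hσ0 k, ?_⟩
  have hρk : (ρ ^ (1 / ((k : ℝ) + 1))) ^ k = cfc (fun x : ℝ => x ^ ((k : ℝ) / (k + 1))) ρ := by
    rw [← CFC.rpow_natCast _ k CFC.rpow_nonneg,
      CFC.rpow_rpow_of_exponent_nonneg _ _ _ (by positivity) (by positivity),
      CFC.rpow_eq_cfc_real, one_div_mul_eq_div]
  rw [hρk, CFC.rpow_eq_cfc_real, trace_cfc_mul_cfc hρh hσh, ← Fintype.sum_prod_type']
  exact hk

/-- Achievability in the quantum Stein lemma. -/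
theorem exists_stein_effect {ρ σ : Matrix X X ℂ} (hρ : IsDensity ρ) (hσ : IsDensity σ) {l : ℝ}
    (hl : (l : EReal) < relEntropy ρ σ) :
    ∃ θ : ℝ, 0 ≤ θ ∧ θ < 1 ∧ ∀ m : ℕ, ∃ P : Matrix (Fin m → X) (Fin m → X) ℂ, IsEffect P ∧
      ((1 - P) * tensorMatrix (Fin m) ρ).trace.re ≤ θ ^ m ∧
      (P * tensorMatrix (Fin m) σ).trace.re ≤ (2 : ℝ) ^ (-(l * m)) := by
  obtain ⟨k, S, T, hS, hT, hSρ, hTσ, hlt⟩ := exists_roots_trace_lt_one hρ hσ hl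
  set c : ℝ := (2 : ℝ) ^ (l / (k + 1)) with hc
  have hc0 : 0 < c := by positivity
  have hθ0 : 0 ≤ c * (S ^ k * T).trace.re :=
    mul_nonneg hc0.le (trace_mul_re_nonneg (hS.pow k) hT)
  refine ⟨c * (S ^ k * T).trace.re, hθ0, hlt, fun m => ?_⟩
  have hcT : ((c : ℂ) • T).PosSemidef := hT.smul (by exact_mod_cast hc0.le)
  -- Since `c^(k+1) = 2^l`, scaling `T` by `c` weights the Type II error `β` by `2^(lm)`. The result
  -- is `α + 2^(lm) β ≤ θ^m`, with `α` the Type I error, which yields both bounds.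
  obtain ⟨P, hP, hle⟩ := exists_effect_trace_le (posSemidef_tensorMatrix (Fin m) hS)
    (posSemidef_tensorMatrix (Fin m) hcT) k
  have him : (S ^ k * T).trace.im = 0 := by
    have : star ((S ^ k * T).trace) = (S ^ k * T).trace := by
      rw [← Matrix.trace_conjTranspose, Matrix.conjTranspose_mul, hT.1.eq, (hS.1.pow k).eq,
        Matrix.trace_mul_comm]
    exact Complex.conj_eq_iff_im.1 this
  have htr : (S ^ k * T).trace = (((S ^ k * T).trace.re : ℝ) : ℂ) :=
    Complex.ext rfl (by simpa using him)
  have hcpow : c ^ (k + 1) = (2 : ℝ) ^ l := by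
    rw [hc, ← Real.rpow_natCast, ← Real.rpow_mul two_pos.le]
    congr 1
    push_cast
    field_simp
  rw [← tensorMatrix_pow, ← tensorMatrix_pow, ← tensorMatrix_pow, ← tensorMatrix_mul, smul_pow,
    hSρ, hTσ, trace_tensorMatrix, Matrix.mul_smul, Matrix.trace_smul, smul_eq_mul, htr,
    ← Complex.ofReal_mul, ← Complex.ofReal_pow, ← Complex.ofReal_pow, Complex.ofReal_re,
    Fintype.card_fin, hcpow, tensorMatrix_smul, Matrix.mul_smul, Matrix.trace_smul,
    ← Complex.ofReal_pow, smul_eq_mul, Complex.re_ofReal_mul, Fintype.card_fin] at hle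
  have h1 : 0 ≤ (P * tensorMatrix (Fin m) σ).trace.re :=
    trace_mul_re_nonneg hP.1 (posSemidef_tensorMatrix _ hσ.1)
  have h2 : 0 ≤ ((1 - P) * tensorMatrix (Fin m) ρ).trace.re :=
    trace_mul_re_nonneg hP.2 (posSemidef_tensorMatrix _ hρ.1)
  have h3 : 0 < ((2 : ℝ) ^ l) ^ m := by positivity
  refine ⟨P, hP, ?_, ?_⟩
  · linarith [mul_nonneg h3.le h1]
  · have h4 : ((2 : ℝ) ^ l) ^ m * (P * tensorMatrix (Fin m) σ).trace.re ≤ 1 := by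
      linarith [pow_le_one₀ (n := m) hθ0 hlt.le]
    rw [Real.rpow_neg two_pos.le, Real.rpow_mul two_pos.le, Real.rpow_natCast]
    rw [← one_div, le_div_iff₀ h3, mul_comm]
    exact h4

end Stein

/-! ### Outputs of tensor-power channels are states. -/

section Output

variable {A : Type u} {B : Type v} [DecidableEq A]

lemma choi_apply (N : Matrix A A ℂ →ₗ[ℂ] Matrix B B ℂ) (p q : A × B) :
    choi N p q = N (Matrix.single p.1 q.1 1) p.2 q.2 := by
  rw [choi, ampliate, Matrix.of_apply]
  rfl

variable [Fintype A]

/-- The output of `N^{⊗ι}`, ampliated by the reference system `R`. -/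
def tensorOutput {R : Type*} {ι : Type*} [Fintype ι] [DecidableEq ι]
    (N : Matrix A A ℂ →ₗ[ℂ] Matrix B B ℂ) (Ψ : Matrix (R × (ι → A)) (R × (ι → A)) ℂ) :
    Matrix (R × (ι → B)) (R × (ι → B)) ℂ :=
  Matrix.of fun p q => ∑ a, ∑ a', Ψ (p.1, a) (q.1, a') *
    ∏ i, N (Matrix.single (a i) (a' i) 1) (p.2 i) (q.2 i)

lemma ampliate_tensorPower (R : Type*) (n : ℕ)
    (N : Matrix A A ℂ →ₗ[ℂ] Matrix B B ℂ)
    (Ψ : Matrix (R × (Fin n → A)) (R × (Fin n → A)) ℂ) :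
    ampliate R (tensorPower n N) Ψ = tensorOutput N Ψ := rfl

lemma map_apply_eq_sum (N : Matrix A A ℂ →ₗ[ℂ] Matrix B B ℂ) (S : Matrix A A ℂ) (b b' : B) :
    N S b b' = ∑ a, ∑ a', S a a' * N (Matrix.single a a' 1) b b' := by
  conv_lhs => rw [Matrix.matrix_eq_sum_single S]
  simp only [map_sum, Matrix.sum_apply]
  refine Finset.sum_congr rfl fun a _ => Finset.sum_congr rfl fun a' _ => ?_
  rw [← mul_one (S a a'), ← smul_eq_mul, ← Matrix.smul_single, map_smul, Matrix.smul_apply]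
  simp

variable [Fintype B]

lemma posSemidef_maxEntangled : (maxEntangled A).PosSemidef := by
  have : maxEntangled A = Matrix.vecMulVec (fun p : A × A => if p.1 = p.2 then (1 : ℂ) else 0)
      (star fun p : A × A => if p.1 = p.2 then (1 : ℂ) else 0) := by
    ext p q
    simp only [maxEntangled, Matrix.of_apply, Matrix.vecMulVec_apply, Pi.star_apply]
    by_cases h1 : p.1 = p.2 <;> by_cases h2 : q.1 = q.2 <;> simp [h1, h2]
  rw [this]
  exact Matrix.posSemidef_vecMulVec_self_star _

lemma IsCPTP.posSemidef_choi {N : Matrix A A ℂ →ₗ[ℂ] Matrix B B ℂ} (hN : IsCPTP N) :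
    (choi N).PosSemidef := by
  set e := Fintype.equivFin A
  have h := hN.1 (Fintype.card A)
    ((maxEntangled A).submatrix (Prod.map e.symm id) (Prod.map e.symm id))
    (posSemidef_maxEntangled.submatrix _)
  convert h.submatrix (Prod.map e id) using 1
  ext p q
  simp [choi, ampliate]

variable {R : Type*} [Fintype R] {ι : Type*} [Fintype ι] [DecidableEq ι]

/-- The output is `Vᴴ Q V`, where `Q` is the Hadamard product of the input with the tensor power of
the Choi matrix and `V` sums over channel inputs; `Q` is positive by the Schur product theorem. -/
lemma posSemidef_tensorOutput {N : Matrix A A ℂ →ₗ[ℂ] Matrix B B ℂ} (hN : IsCPTP N)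
    {Ψ : Matrix (R × (ι → A)) (R × (ι → A)) ℂ} (hΨ : Ψ.PosSemidef) :
    (tensorOutput N Ψ).PosSemidef := by
  classical
  set Q : Matrix ((R × (ι → B)) × (ι → A)) ((R × (ι → B)) × (ι → A)) ℂ :=
    Matrix.hadamard (Ψ.submatrix (fun x => (x.1.1, x.2)) (fun x => (x.1.1, x.2)))
      ((tensorMatrix ι (choi N)).submatrix (fun x i => (x.2 i, x.1.2 i))
        (fun x i => (x.2 i, x.1.2 i))) with hQ
  have hQpos : Q.PosSemidef := (hΨ.submatrix _).hadamard
    ((posSemidef_tensorMatrix ι hN.posSemidef_choi).submatrix _)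
  set V : Matrix ((R × (ι → B)) × (ι → A)) (R × (ι → B)) ℂ :=
    Matrix.of fun x p => if x.1 = p then 1 else 0 with hV
  convert hQpos.conjTranspose_mul_mul_same V using 1
  ext p q
  simp only [Matrix.mul_apply, Matrix.conjTranspose_apply, hV, Matrix.of_apply,
    Fintype.sum_prod_type_right, apply_ite star, star_one, star_zero, ite_mul, one_mul,
    zero_mul, mul_ite, mul_one, mul_zero, Finset.sum_ite_eq', Finset.mem_univ, if_true,
    hQ, Matrix.hadamard_apply, Matrix.submatrix_apply, tensorMatrix, choi_apply, tensorOutput]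
  rw [Finset.sum_comm]

lemma trace_tensorOutput {N : Matrix A A ℂ →ₗ[ℂ] Matrix B B ℂ} (hN : IsCPTP N)
    (Ψ : Matrix (R × (ι → A)) (R × (ι → A)) ℂ) : (tensorOutput N Ψ).trace = Ψ.trace := by
  have hone : ∀ a a' : A, ∑ b, N (Matrix.single a a' 1) b b = if a = a' then 1 else 0 :=
    fun a a' => by
      have := hN.2 (Matrix.single a a' 1)
      rw [Matrix.trace] at this
      simp only [Matrix.diag_apply] at this
      rw [this]
      split_ifs with h
      · subst h; simp
      · exact Matrix.trace_single_eq_of_ne a a' 1 h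
  have hprod : ∀ a a' : ι → A, ∑ b : ι → B, ∏ i, N (Matrix.single (a i) (a' i) 1) (b i) (b i) =
      if a = a' then 1 else 0 := fun a a' => by
    rw [← Fintype.piFinset_univ, ← Finset.prod_univ_sum (fun _ : ι => Finset.univ)
      (fun i b => N (Matrix.single (a i) (a' i) 1) b b)]
    simp only [hone, Finset.prod_ite_zero]
    simp [funext_iff]
  simp only [Matrix.trace, Matrix.diag_apply, tensorOutput, Matrix.of_apply,
    Fintype.sum_prod_type]
  refine Finset.sum_congr rfl fun r _ => ?_
  rw [Finset.sum_comm]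
  refine Finset.sum_congr rfl fun a _ => ?_
  rw [Finset.sum_comm]
  simp only [← Finset.mul_sum, hprod]
  simp

lemma isDensity_tensorOutput {N : Matrix A A ℂ →ₗ[ℂ] Matrix B B ℂ} (hN : IsCPTP N)
    {Ψ : Matrix (R × (ι → A)) (R × (ι → A)) ℂ} (hΨ : IsDensity Ψ) :
    IsDensity (tensorOutput N Ψ) :=
  ⟨posSemidef_tensorOutput hN hΨ.1, (trace_tensorOutput hN Ψ).trans hΨ.2⟩

end Output

lemma IsCPTP.isDensity_map {A : Type u} {B : Type v} [Fintype A] [Fintype B]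
    {N : Matrix A A ℂ →ₗ[ℂ] Matrix B B ℂ} (hN : IsCPTP N) {χ : Matrix A A ℂ}
    (hχ : IsDensity χ) : IsDensity (N χ) := by
  refine ⟨?_, (hN.2 χ).trans hχ.2⟩
  have h := hN.1 1 (χ.submatrix Prod.snd Prod.snd) (hχ.1.submatrix _)
  have h2 := h.submatrix (fun b => ((0 : Fin 1), b))
  exact h2

/-! ### Invariance of states, effects and traces under relabeling and ancillas. -/

section Reindexing

lemma trace_submatrix_equiv {X Y : Type*} [Fintype X] [Fintype Y] (e : Y ≃ X)
    (S : Matrix X X ℂ) : (S.submatrix e e).trace = S.trace := by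
  simp only [Matrix.trace, Matrix.diag_apply, Matrix.submatrix_apply]
  exact e.sum_comp fun x => S x x

lemma trace_submatrix_mul_submatrix {X Y : Type*} [Fintype X] [Fintype Y] (e : Y ≃ X)
    (S T : Matrix X X ℂ) : (S.submatrix e e * T.submatrix e e).trace = (S * T).trace := by
  rw [Matrix.submatrix_mul_equiv, trace_submatrix_equiv]

lemma IsDensity.submatrix {X Y : Type*} [Fintype X] [Fintype Y]
    {S : Matrix X X ℂ} (hS : IsDensity S) (e : Y ≃ X) : IsDensity (S.submatrix e e) :=
  ⟨hS.1.submatrix e, by rw [trace_submatrix_equiv, hS.2]⟩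

lemma one_sub_submatrix {X Y : Type*} [DecidableEq X] [DecidableEq Y]
    (P : Matrix X X ℂ) (e : Y ≃ X) : 1 - P.submatrix e e = (1 - P).submatrix e e := by
  rw [Matrix.submatrix_sub, Pi.sub_apply, Pi.sub_apply, Matrix.submatrix_one_equiv]

lemma IsEffect.submatrix {X Y : Type*} [Fintype X] [DecidableEq X] [Fintype Y] [DecidableEq Y]
    {P : Matrix X X ℂ} (hP : IsEffect P) (e : Y ≃ X) : IsEffect (P.submatrix e e) :=
  ⟨hP.1.submatrix e, one_sub_submatrix P e ▸ hP.2.submatrix e⟩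

open scoped Kronecker

lemma one_sub_kronecker_one {X Y : Type*} [DecidableEq X] [DecidableEq Y] (P : Matrix X X ℂ) :
    1 - P ⊗ₖ (1 : Matrix Y Y ℂ) = (1 - P) ⊗ₖ (1 : Matrix Y Y ℂ) := by
  ext x y
  by_cases h : x.2 = y.2 <;> simp [Matrix.one_apply, Prod.ext_iff, h]

lemma IsEffect.kronecker_one {X Y : Type*} [Fintype X] [DecidableEq X] [Fintype Y] [DecidableEq Y]
    {P : Matrix X X ℂ} (hP : IsEffect P) : IsEffect (P ⊗ₖ (1 : Matrix Y Y ℂ)) :=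
  ⟨hP.1.kronecker Matrix.PosSemidef.one,
    one_sub_kronecker_one (Y := Y) P ▸ hP.2.kronecker Matrix.PosSemidef.one⟩

lemma IsDensity.kronecker {X Y : Type*} [Fintype X] [Fintype Y]
    {S : Matrix X X ℂ} {T : Matrix Y Y ℂ} (hS : IsDensity S) (hT : IsDensity T) :
    IsDensity (S ⊗ₖ T) :=
  ⟨hS.1.kronecker hT.1, by rw [Matrix.trace_kronecker, hS.2, hT.2, one_mul]⟩

lemma trace_kronecker_one_mul {X Y : Type*} [Fintype X] [Fintype Y] [DecidableEq Y]
    (P S : Matrix X X ℂ) {T : Matrix Y Y ℂ} (hT : IsDensity T) :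
    (P ⊗ₖ (1 : Matrix Y Y ℂ) * S ⊗ₖ T).trace = (P * S).trace := by
  rw [← Matrix.mul_kronecker_mul, one_mul, Matrix.trace_kronecker, hT.2, mul_one]

end Reindexing

/-! ### Product inputs give product outputs. -/

section Products

variable {A : Type u} {B : Type v} [Fintype A] [DecidableEq A]

lemma tensorOutput_submatrix {R R' ι ι' : Type*} [Fintype ι] [DecidableEq ι] [Fintype ι']
    [DecidableEq ι'] (N : Matrix A A ℂ →ₗ[ℂ] Matrix B B ℂ) (f : R' ≃ R) (e : ι' ≃ ι)
    (Ψ : Matrix (R × (ι → A)) (R × (ι → A)) ℂ) :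
    tensorOutput N (Ψ.submatrix (f.prodCongr (e.arrowCongr (.refl A)))
      (f.prodCongr (e.arrowCongr (.refl A)))) =
    (tensorOutput N Ψ).submatrix (f.prodCongr (e.arrowCongr (.refl B)))
      (f.prodCongr (e.arrowCongr (.refl B))) := by
  ext p q
  simp only [tensorOutput, Matrix.of_apply, Matrix.submatrix_apply]
  rw [← (e.arrowCongr (.refl A)).sum_comp]
  refine Finset.sum_congr rfl fun a _ => ?_
  rw [← (e.arrowCongr (.refl A)).sum_comp]
  refine Finset.sum_congr rfl fun a' _ => ?_
  rw [← e.prod_comp]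
  simp

/-- Regrouping of `μ` copies of `R ⊗ A^κ`. -/
def blockEquiv (μ κ R A : Type*) : (μ → R) × (μ × κ → A) ≃ (μ → R × (κ → A)) where
  toFun p j := (p.1 j, fun i => p.2 (j, i))
  invFun z := (fun j => (z j).1, fun x => (z x.1).2 x.2)
  left_inv _ := rfl
  right_inv _ := rfl

lemma tensorOutput_block {R μ κ : Type*} [Fintype μ] [DecidableEq μ] [Fintype κ]
    [DecidableEq κ] (N : Matrix A A ℂ →ₗ[ℂ] Matrix B B ℂ)
    (ψ : Matrix (R × (κ → A)) (R × (κ → A)) ℂ) :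
    tensorOutput N ((tensorMatrix μ ψ).submatrix (blockEquiv μ κ R A) (blockEquiv μ κ R A)) =
      (tensorMatrix μ (tensorOutput N ψ)).submatrix (blockEquiv μ κ R B)
        (blockEquiv μ κ R B) := by
  ext p q
  simp only [tensorOutput, tensorMatrix, Matrix.of_apply, Matrix.submatrix_apply,
    Finset.prod_univ_sum, Fintype.piFinset_univ]
  rw [← (Equiv.curry μ κ A).sum_comp]
  refine Finset.sum_congr rfl fun a _ => ?_
  rw [← (Equiv.curry μ κ A).sum_comp]
  refine Finset.sum_congr rfl fun a' _ => ?_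
  rw [Fintype.prod_prod_type, ← Finset.prod_mul_distrib]
  rfl

/-- Splitting off of the systems indexed by `τ`. -/
def padEquiv (R ι τ A : Type*) : R × (ι ⊕ τ → A) ≃ (R × (ι → A)) × (τ → A) :=
  ((Equiv.refl R).prodCongr (Equiv.sumArrowEquivProdArrow ι τ A)).trans
    (Equiv.prodAssoc R (ι → A) (τ → A)).symm

open scoped Kronecker in
lemma tensorOutput_pad {R ι τ : Type*} [Fintype ι] [DecidableEq ι] [Fintype τ]
    [DecidableEq τ] (N : Matrix A A ℂ →ₗ[ℂ] Matrix B B ℂ)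
    (Ψ : Matrix (R × (ι → A)) (R × (ι → A)) ℂ) (χ : Matrix A A ℂ) :
    tensorOutput N ((Ψ ⊗ₖ tensorMatrix τ χ).submatrix (padEquiv R ι τ A) (padEquiv R ι τ A)) =
      (tensorOutput N Ψ ⊗ₖ tensorMatrix τ (N χ)).submatrix (padEquiv R ι τ B)
        (padEquiv R ι τ B) := by
  ext p q
  simp only [tensorOutput, tensorMatrix, Matrix.of_apply, Matrix.submatrix_apply,
    Matrix.kroneckerMap_apply]
  simp only [map_apply_eq_sum N χ, Finset.prod_univ_sum, Fintype.piFinset_univ]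
  rw [← (Equiv.sumArrowEquivProdArrow ι τ A).symm.sum_comp, Fintype.sum_prod_type,
    Finset.sum_mul]
  refine Finset.sum_congr rfl fun a _ => ?_
  rw [Finset.mul_sum]
  refine Finset.sum_congr rfl fun c _ => ?_
  rw [← (Equiv.sumArrowEquivProdArrow ι τ A).symm.sum_comp, Fintype.sum_prod_type,
    Finset.sum_mul]
  refine Finset.sum_congr rfl fun a' _ => ?_
  rw [Finset.mul_sum]
  refine Finset.sum_congr rfl fun c' _ => ?_
  rw [Fintype.prod_sum_type, Finset.prod_mul_distrib]
  simp only [padEquiv, Equiv.trans_apply, Equiv.prodCongr_apply, Prod.map, Equiv.refl_apply,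
    Equiv.apply_symm_apply, Equiv.prodAssoc_symm_apply, Equiv.sumArrowEquivProdArrow_apply_fst,
    Equiv.sumArrowEquivProdArrow_apply_snd, Equiv.sumArrowEquivProdArrow_symm_apply_inl,
    Equiv.sumArrowEquivProdArrow_symm_apply_inr]
  ring

end Products

/-! ### Construction of coherent strategies. -/

section Strategies

variable {A : Type u} {B : Type v} [Fintype A] [DecidableEq A] [Fintype B] [DecidableEq B]

/-- A strategy with arbitrary index types yields a coherent strategy with the same errors. -/
lemma exists_coherentStrategy {R ι : Type*} [Fintype R] [DecidableEq R] [Fintype ι]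
    [DecidableEq ι] {n : ℕ} (hn : Fintype.card ι = n)
    {Ψ : Matrix (R × (ι → A)) (R × (ι → A)) ℂ} (hΨ : IsDensity Ψ)
    {P : Matrix (R × (ι → B)) (R × (ι → B)) ℂ} (hP : IsEffect P) :
    ∃ S : CoherentStrategy A B n, ∀ G : Matrix A A ℂ →ₗ[ℂ] Matrix B B ℂ,
      S.typeI G = ((1 - P) * tensorOutput G Ψ).trace.re ∧
      S.typeII G = (P * tensorOutput G Ψ).trace.re := by
  set e : Fin n ≃ ι := (Fintype.equivFinOfCardEq hn).symm
  set f : Fin (Fintype.card R) ≃ R := (Fintype.equivFin R).symm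
  refine ⟨⟨Fintype.card R, _, hΨ.submatrix (f.prodCongr (e.arrowCongr (.refl A))), _,
    hP.submatrix (f.prodCongr (e.arrowCongr (.refl B)))⟩, fun G => ⟨?_, ?_⟩⟩
  · simp only [CoherentStrategy.typeI, CoherentStrategy.testState, ampliate_tensorPower,
      tensorOutput_submatrix, one_sub_submatrix, trace_submatrix_mul_submatrix]
  · simp only [CoherentStrategy.typeII, CoherentStrategy.testState, ampliate_tensorPower,
      tensorOutput_submatrix, trace_submatrix_mul_submatrix]

lemma isDensity_single (a : A) : IsDensity (Matrix.single a a (1 : ℂ)) := by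
  refine ⟨?_, by simp⟩
  rw [← Matrix.diagonal_single]
  refine Matrix.PosSemidef.diagonal fun b => ?_
  by_cases h : b = a
  · subst h; simp
  · simp [h]

open scoped Kronecker in
/-- A test on `m` copies of the output of `k` channel uses, as a strategy for `n ≥ m k` uses. -/
lemma exists_coherentStrategy_block [Nonempty A] {R : Type*} [Fintype R] [DecidableEq R] {k m n : ℕ}
    (hn : m * k ≤ n) {ψ : Matrix (R × (Fin k → A)) (R × (Fin k → A)) ℂ} (hψ : IsDensity ψ)
    {P : Matrix (Fin m → R × (Fin k → B)) (Fin m → R × (Fin k → B)) ℂ} (hP : IsEffect P) :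
    ∃ S : CoherentStrategy A B n, ∀ G : Matrix A A ℂ →ₗ[ℂ] Matrix B B ℂ, IsCPTP G →
      S.typeI G = ((1 - P) * tensorMatrix (Fin m) (tensorOutput G ψ)).trace.re ∧
      S.typeII G = (P * tensorMatrix (Fin m) (tensorOutput G ψ)).trace.re := by
  obtain ⟨a⟩ := ‹Nonempty A›
  have hχ := isDensity_single a
  -- The `n - m * k` spare uses receive a basis state and are measured by the identity, so they
  -- contribute a factor `1` to every trace.
  obtain ⟨S, hS⟩ := exists_coherentStrategy
    (ι := (Fin m × Fin k) ⊕ Fin (n - m * k)) (n := n) (by simp; omega)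
    ((((isDensity_tensorMatrix (Fin m) hψ).submatrix (blockEquiv _ _ _ _)).kronecker
      (isDensity_tensorMatrix (Fin (n - m * k)) hχ)).submatrix (padEquiv _ _ _ _))
    (((hP.submatrix (blockEquiv _ _ _ _)).kronecker_one (Y := Fin (n - m * k) → B)).submatrix
      (padEquiv _ _ _ _))
  refine ⟨S, fun G hG => ?_⟩
  have hGχ := isDensity_tensorMatrix (Fin (n - m * k)) (hG.isDensity_map hχ)
  rw [(hS G).1, (hS G).2, tensorOutput_pad, tensorOutput_block, one_sub_submatrix,
    trace_submatrix_mul_submatrix, trace_submatrix_mul_submatrix, one_sub_kronecker_one,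
    trace_kronecker_one_mul _ _ hGχ, trace_kronecker_one_mul _ _ hGχ, one_sub_submatrix,
    trace_submatrix_mul_submatrix, trace_submatrix_mul_submatrix]
  exact ⟨rfl, rfl⟩

end Strategies

/-! ### Extended-real logarithms. -/

section Log

lemma log2_le_coe_iff {x z : ℝ} : log2 x ≤ z ↔ x ≤ (2 : ℝ) ^ z := by
  rw [log2]
  split_ifs with h
  · exact ⟨fun _ => h.trans (by positivity), fun _ => bot_le⟩
  · push Not at h
    rw [EReal.coe_le_coe_iff, Real.logb_le_iff_le_rpow one_lt_two h]

lemma log2_lt_coe_iff {x z : ℝ} : log2 x < z ↔ x < (2 : ℝ) ^ z := by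
  rw [log2]
  split_ifs with h
  · exact ⟨fun _ => h.trans_lt (by positivity), fun _ => EReal.bot_lt_coe z⟩
  · push Not at h
    rw [EReal.coe_lt_coe_iff, Real.logb_lt_iff_lt_rpow one_lt_two h]

lemma log2_mono {x y : ℝ} (h : x ≤ y) : log2 x ≤ log2 y :=
  EReal.le_of_forall_lt_iff_le.1 fun _ hz =>
    log2_le_coe_iff.2 (h.trans (log2_lt_coe_iff.1 hz).le)

lemma log2_zero : log2 0 = ⊥ := if_pos le_rfl

/-- `-log` turns infima into suprema. -/
lemma neg_log2_sInf_le {s : Set ℝ} (hs : s.Nonempty) {C : EReal}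
    (h : ∀ x ∈ s, -log2 x ≤ C) : -log2 (sInf s) ≤ C := by
  refine EReal.ge_of_forall_gt_iff_ge.1 fun z hz => ?_
  rw [EReal.lt_neg_comm, ← EReal.coe_neg, log2_lt_coe_iff] at hz
  obtain ⟨x, hx, hxz⟩ := exists_lt_of_csInf_lt hs hz
  refine le_trans ?_ (h x hx)
  rw [EReal.le_neg, ← EReal.coe_neg]
  exact log2_le_coe_iff.2 hxz.le

/-- Moving the factor across lets a supremum, possibly infinite, be bounded term by term. -/
lemma coe_one_div_mul_le_iff {n : ℕ} (hn : 1 ≤ n) {a b : EReal} :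
    ((1 / (n : ℝ) : ℝ) : EReal) * a ≤ b ↔ a ≤ b / ((1 / (n : ℝ) : ℝ) : EReal) := by
  have : (0 : ℝ) < n := by exact_mod_cast hn
  rw [EReal.le_div_iff_mul_le (by exact_mod_cast one_div_pos.2 this) (EReal.coe_ne_top _), mul_comm]

end Log

/-! ### The two bounds on the Stein exponent. -/

section Exponents

variable {A : Type u} {B : Type v} [Fintype A] [DecidableEq A] [Fintype B] [DecidableEq B]
  {N M : Matrix A A ℂ →ₗ[ℂ] Matrix B B ℂ} {ε : ℝ}

/-- Optimizing over inputs and tests separately or jointly gives the same exponent. -/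
theorem coherentHypTestEntropy_eq (hN : IsCPTP N) (hM : IsCPTP M) (hε : 0 ≤ ε) (n : ℕ) :
    coherentHypTestEntropy ε N M n =
      channelHypTestEntropy ε (tensorPower n N) (tensorPower n M) := by
  have htr : ∀ {d : ℕ} {ψ : Matrix (Fin d × (Fin n → A)) (Fin d × (Fin n → A)) ℂ}
      (_ : IsDensity ψ) (P : Matrix (Fin d × (Fin n → B)) (Fin d × (Fin n → B)) ℂ),
      ((1 - P) * tensorOutput N ψ).trace.re = 1 - (P * tensorOutput N ψ).trace.re := by
    intro d ψ hψ P
    rw [sub_mul, one_mul, Matrix.trace_sub, (isDensity_tensorOutput hN hψ).2, Complex.sub_re,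
      Complex.one_re]
  apply le_antisymm
  · refine iSup₂_le fun S hS => ?_
    refine le_iSup_of_le S.refDim (le_iSup₂_of_le S.input S.input_isDensity ?_)
    rw [hypTestEntropy, EReal.neg_le_neg_iff]
    refine log2_mono (csInf_le ⟨0, ?_⟩ ⟨S.effect, S.effect_isEffect, ?_, rfl⟩)
    · rintro _ ⟨P, hP, -, rfl⟩
      exact trace_mul_re_nonneg hP.1 (posSemidef_tensorOutput hM S.input_isDensity.1)
    · have := htr S.input_isDensity S.effect
      rw [CoherentStrategy.typeI, CoherentStrategy.testState, ampliate_tensorPower, this] at hS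
      rw [ampliate_tensorPower]
      linarith
  · refine iSup_le fun d => iSup₂_le fun ψ hψ => ?_
    refine neg_log2_sInf_le ?_ ?_
    -- Feasibility of the trivial test matters: `sInf ∅ = 0` would give the value `⊤`.
    · refine ⟨_, 1, ⟨Matrix.PosSemidef.one, ?_⟩, ?_, rfl⟩
      · rw [sub_self]; exact Matrix.PosSemidef.zero
      rw [one_mul, ampliate_tensorPower, (isDensity_tensorOutput hN hψ).2, Complex.one_re]
      linarith
    · rintro _ ⟨P, hP, hle, rfl⟩
      refine le_iSup₂_of_le (⟨d, ψ, hψ, P, hP⟩ : CoherentStrategy A B n) ?_ le_rfl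
      rw [ampliate_tensorPower] at hle
      rw [CoherentStrategy.typeI, CoherentStrategy.testState, ampliate_tensorPower, htr hψ]
      linarith

lemma tendsto_div_div_atTop {k : ℕ} :
    Tendsto (fun n : ℕ => (((n / k : ℕ) : ℝ)) / n) atTop (𝓝 (1 / (k : ℝ))) := by
  have h := (tendsto_nat_floor_mul_div_atTop (R := ℝ) (a := 1 / (k : ℝ)) (by positivity)).comp
    tendsto_natCast_atTop_atTop
  refine h.congr fun n => ?_
  rw [Function.comp_apply, one_div_mul_eq_div, Nat.floor_div_eq_div]

/-- Achievability: the regularized relative entropy is a lower bound for the Stein exponent. -/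
theorem regRelEntropy_le_liminf [Nonempty A] (hN : IsCPTP N) (hM : IsCPTP M) (hε : 0 < ε) :
    regRelEntropy N M ≤ liminf (fun n : ℕ => ((1 / (n : ℝ) : ℝ) : EReal) *
      coherentHypTestEntropy ε N M n) atTop := by
  refine iSup₂_le fun k hk => ?_
  rw [coe_one_div_mul_le_iff hk]
  refine iSup_le fun d => iSup₂_le fun ψ hψ => EReal.ge_of_forall_gt_iff_ge.1 fun l hl => ?_
  rw [← coe_one_div_mul_le_iff hk]
  rw [ampliate_tensorPower, ampliate_tensorPower] at hl
  obtain ⟨θ, hθ0, hθ1, hθ⟩ := exists_stein_effect (isDensity_tensorOutput hN hψ)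
    (isDensity_tensorOutput hM hψ) hl
  have hlim : Tendsto (fun n : ℕ => ((((n / k : ℕ) : ℝ) / n * l : ℝ) : EReal)) atTop
      (𝓝 (((1 / (k : ℝ) : ℝ) : EReal) * l)) := by
    rw [← EReal.coe_mul]
    exact (continuous_coe_real_ereal.tendsto _).comp (tendsto_div_div_atTop.mul_const l)
  rw [← hlim.liminf_eq]
  refine liminf_le_liminf ?_
  -- Any fixed `ε > 0` is eventually met because the Type I error decays exponentially in the number
  -- of blocks.
  have hsmall : ∀ᶠ n : ℕ in atTop, θ ^ (n / k) < ε :=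
    ((tendsto_pow_atTop_nhds_zero_of_lt_one hθ0 hθ1).comp
      (Nat.tendsto_div_const_atTop (by omega))).eventually_lt_const hε
  filter_upwards [hsmall, eventually_ge_atTop 1] with n hn hn1
  obtain ⟨P, hP, hα, hβ⟩ := hθ (n / k)
  obtain ⟨S, hS⟩ := exists_coherentStrategy_block (Nat.div_mul_le_self n k) hψ hP
  have hSα : S.typeI N ≤ ε := by rw [(hS N hN).1]; exact hα.trans hn.le
  have hSβ : ((l * ((n / k : ℕ) : ℝ) : ℝ) : EReal) ≤ -log2 (S.typeII M) := by
    rw [EReal.le_neg, ← EReal.coe_neg, log2_le_coe_iff, (hS M hM).2]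
    exact hβ
  have hle : ((l * ((n / k : ℕ) : ℝ) : ℝ) : EReal) ≤ coherentHypTestEntropy ε N M n :=
    hSβ.trans (le_iSup₂_of_le S hSα le_rfl)
  have h0 : (0 : EReal) ≤ ((1 / (n : ℝ) : ℝ) : EReal) := by
    exact_mod_cast (by positivity : (0 : ℝ) ≤ 1 / (n : ℝ))
  refine le_trans (le_of_eq ?_) (mul_le_mul_of_nonneg_left hle h0)
  rw [← EReal.coe_mul]
  congr 1
  ring

/-- Never accepting has exponent `+∞`; such strategies fill indices without harming a liminf. -/
lemma exists_coherentStrategy_typeII_eq_zero [Nonempty A] (M : Matrix A A ℂ →ₗ[ℂ] Matrix B B ℂ)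
    (n : ℕ) : ∃ S : CoherentStrategy A B n, S.typeII M = 0 := by
  obtain ⟨a⟩ := ‹Nonempty A›
  obtain ⟨S, hS⟩ := exists_coherentStrategy (B := B) (Fintype.card_fin n)
    (isDensity_single ((0 : Fin 1), fun _ : Fin n => a)) (P := 0)
    ⟨Matrix.PosSemidef.zero, by rw [sub_zero]; exact Matrix.PosSemidef.one⟩
  exact ⟨S, by rw [(hS M).2]; simp⟩

/-- Converse: under the exponentially strong converse property the regularized relative entropy
is an upper bound for the Stein exponent. -/
theorem limsup_le_regRelEntropy [Nonempty A] (hε : ε < 1) (hsc : ExpStrongConverse N M) :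
    limsup (fun n : ℕ => ((1 / (n : ℝ) : ℝ) : EReal) * coherentHypTestEntropy ε N M n) atTop ≤
      regRelEntropy N M := by
  classical
  by_contra! hlt
  obtain ⟨c, hc, hclim⟩ := exists_between hlt
  have hfreq := frequently_lt_of_lt_limsup (by isBoundedDefault) hclim
  have hgood : ∀ n : ℕ, 1 ≤ n → c < ((1 / (n : ℝ) : ℝ) : EReal) * coherentHypTestEntropy ε N M n →
      ∃ S : CoherentStrategy A B n, S.typeI N ≤ ε ∧
        c < ((1 / (n : ℝ) : ℝ) : EReal) * (-log2 (S.typeII M)) := by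
    intro n hn h
    by_contra! hcon
    refine absurd h (not_lt.2 ((coe_one_div_mul_le_iff hn).2 (iSup₂_le fun S hS => ?_)))
    exact (coe_one_div_mul_le_iff hn).1 (hcon S hS)
  -- The strong converse needs the exponent bound at almost every `n`, while Type I control is
  -- available, and needed, only along the frequent good indices. The index `n = 0`, where `1 / n =
  -- 0`, is excluded.
  have hall : ∀ n : ℕ, ∃ S : CoherentStrategy A B n, 1 ≤ n →
      c ≤ ((1 / (n : ℝ) : ℝ) : EReal) * (-log2 (S.typeII M)) ∧
      (c < ((1 / (n : ℝ) : ℝ) : EReal) * coherentHypTestEntropy ε N M n → S.typeI N ≤ ε) := by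
    intro n
    by_cases h : 1 ≤ n ∧ c < ((1 / (n : ℝ) : ℝ) : EReal) * coherentHypTestEntropy ε N M n
    · obtain ⟨S, hS, hcS⟩ := hgood n h.1 h.2
      exact ⟨S, fun _ => ⟨hcS.le, fun _ => hS⟩⟩
    · obtain ⟨S, hS⟩ := exists_coherentStrategy_typeII_eq_zero M n
      refine ⟨S, fun hn => ⟨?_, fun h2 => absurd ⟨hn, h2⟩ h⟩⟩
      have : (0 : ℝ) < n := by exact_mod_cast hn
      rw [hS, log2_zero, EReal.neg_bot, EReal.coe_mul_top_of_pos (one_div_pos.2 this)]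
      exact le_top
  choose S hS using hall
  have hliminf : regRelEntropy N M < liminf (fun n : ℕ => ((1 / (n : ℝ) : ℝ) : EReal) *
      (-log2 ((S n).typeII M))) atTop := by
    refine hc.trans_le (le_liminf_of_le (by isBoundedDefault) ?_)
    filter_upwards [eventually_ge_atTop 1] with n hn using (hS n hn).1
  obtain ⟨b, hb, hev⟩ := hsc S hliminf
  have hzero : Tendsto (fun n : ℕ => (2 : ℝ) ^ (-(b * (n : ℝ)))) atTop (𝓝 0) := by
    have hpow := tendsto_pow_atTop_nhds_zero_of_lt_one (r := (2 : ℝ) ^ (-b)) (by positivity)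
      (Real.rpow_lt_one_of_one_lt_of_neg one_lt_two (by linarith))
    refine hpow.congr fun n => ?_
    rw [← Real.rpow_natCast, ← Real.rpow_mul two_pos.le, neg_mul]
  -- At a large good index, `1 - ε ≤ 1 - α_n ≤ 2^(-bn) < 1 - ε`.
  obtain ⟨n, hn, hle, hsm, hn1⟩ := (hfreq.and_eventually (hev.and
    ((hzero.eventually_lt_const (sub_pos.2 hε)).and (eventually_ge_atTop 1)))).exists
  linarith [(hS n hn1).2 hn]

end Exponents

end ChannelStein

end

theorem mainTheorem1 {A : Type*} {B : Type*} [Fintype A] [DecidableEq A] [Nonempty A]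
    [Fintype B] [DecidableEq B] (N M : Matrix A A ℂ →ₗ[ℂ] Matrix B B ℂ)
    (hN : ChannelStein.IsCPTP N) (hM : ChannelStein.IsCPTP M)
    (hpos : (ChannelStein.choi N).PosDef) (ε : ℝ) (hε : ε ∈ Set.Ioo (0 : ℝ) 1) :
    ChannelStein.regRelEntropy N M ≤
        Filter.liminf (fun n : ℕ => ((1 / (n : ℝ) : ℝ) : EReal) *
          ChannelStein.channelHypTestEntropy ε
            (ChannelStein.tensorPower n N) (ChannelStein.tensorPower n M)) Filter.atTop ∧
    (ChannelStein.ExpStrongConverse N M →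
      Filter.Tendsto (fun n : ℕ => ((1 / (n : ℝ) : ℝ) : EReal) *
          ChannelStein.channelHypTestEntropy ε
            (ChannelStein.tensorPower n N) (ChannelStein.tensorPower n M))
        Filter.atTop (nhds (ChannelStein.regRelEntropy N M)) ∧
      ChannelStein.steinExponentSup ε N M = ChannelStein.regRelEntropy N M ∧
      ChannelStein.steinExponentInf ε N M = ChannelStein.regRelEntropy N M) := by
  have hlow := ChannelStein.regRelEntropy_le_liminf hN hM hε.1
  simp only [← ChannelStein.coherentHypTestEntropy_eq hN hM hε.1.le]
  refine ⟨hlow, fun hsc => ?_⟩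
  have hlim := tendsto_of_le_liminf_of_limsup_le hlow
    (ChannelStein.limsup_le_regRelEntropy hε.2 hsc)
  exact ⟨hlim, hlim.limsup_eq, hlim.liminf_eq⟩
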